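/- A commutative partial semigroup is a set $S$ with a partial binary operation $+$ such that, for all $a,b,c\in S$, $(a+b)+c=a+(b+c)$ and $a+b=b+a$, in the sense that if either side is defined then so is the other and they are equal. For finite $H\subseteq S$ let $\sigma(H)=\{t\in S: s+t \text{ is defined for all } s\in H\}$; $S$ is adequate if $\sigma(H)\neq\emptyset$ for every nonempty finite $H\subseteq S$. For $a\in S$, $A\subseteq S$ put $-a+A=\{t\in S: a+t\text{ is defined and } a+t\in A\}$. Let $\delta S$ be the set of all ultrafilters $p$ on $S$ with $\sigma(\{x\})\in p$ for every $x\in S$, with the operation given by $A\in p+q\iff\{a\in S:-a+A\in q\}\in p$, and let $K(\delta S)$ be the union of all minimal left ideals of $\delta S$. A set is central if it belongs to some idempotent of $K(\delta S)$. A family $\mathcal A$ of nonempty finite subsets of $S$ is shift invariant if $A+x=\{a+x:a\in A\}\in\mathcal A$ for all $A\in\mathcal A$ and $x\in\sigma(A)$. It is adequately partition regular if for every finite $H\subseteq S$ and every integer $r\ge 1$ there is a finite $F\subseteq\sigma(H)$ such that whenever $F=\bigcup_{i=1}^r D_i$, some $D_j$ contains a member of $\mathcal A$. Theorem. Let $(S,+)$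 be a commutative adequate partial semigroup, let $U$ be a set, and for each $s\in U$ let $T_s$ be a set. For each $s\in U$ and $t\in T_s$ let $A_{s,t}$ be a nonempty finite subset of $S$, such that for every $s\in U$ the family $\mathcal A_s=\{A_{s,t}:t\in T_s\}$ is shift invariant and adequately partition regular. Let $s_1\in U$ and let $\phi:\bigcup_{s\in U}(\{s\}\times T_s)\to U$ be a function. Let $(C_n)_{n=1}^\infty$ be a sequence of sets central with respect to a common idempotent, i.e. there is an idempotent $p\in K(\delta S)$ with $C_n\in p$ for every $n$. Then there exist sequences $(s_n)_{n=2}^\infty$ in $U$ and $(t_n)_{n=1}^\infty$ with $t_n\in T_{s_n}$ for every $n\ge1$ such that $s_n=\phi(s_{n-1},t_{n-1})$ for all $n\ge 2$ and such that, whenever $m\ge1$, $n_1<n_2<\dots<n_m$ and $x_{n_i}\in A_{s_{n_i},t_{n_i}}$ for each $i\in\{1,\dots,m\}$, the sum $x_{n_1}+x_{n_2}+\dots+x_{n_m}$ is defined and belongs to $C_{n_1}$. -/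

import Mathlib

/-- A commutative partial semigroup, written additively. The partial operation is
`padd : S → S → Option S`, where `padd a b = none` means that `a + b` is not defined.
Equality of `Option` values in `padd_assoc` says: if either side is defined, then so is the
other, and they are equal. -/
class PartialAddCommSemigroup (S : Type*) where
  padd : S → S → Option S
  padd_assoc : ∀ a b c : S,
    (padd a b).bind (fun x => padd x c) = (padd b c).bind (fun x => padd a x)
  padd_comm : ∀ a b : S, padd a b = padd b a

namespace PartialAddCommSemigroup

variable {S : Type*} [PartialAddCommSemigroup S]

/-- `dom s = {t : s + t is defined}`. -/
def dom (s : S) : Set S := {t | ∃ u, padd s t = some u}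

/-- `sig H = {t : s + t is defined for all s ∈ H}`; in particular `sig ∅ = S`. -/
def sig (H : Finset S) : Set S := {t | ∀ s ∈ H, t ∈ dom s}

/-- `shiftSet s A = -s + A = {t : s + t is defined and lies in A}`. -/
def shiftSet (s : S) (A : Set S) : Set S := {t | ∃ u ∈ A, padd s t = some u}

variable (S) in
/-- `S` is adequate if `sig H` is nonempty for every nonempty finite `H ⊆ S`. -/
def IsAdequate : Prop := ∀ H : Finset S, H.Nonempty → (sig H).Nonempty

/-- The left-nested iterated sum `(⋯(x₀ + x₁) + ⋯) + xₘ`; its value is `none` if the sum is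
not defined. -/
def psum : (m : ℕ) → (Fin (m + 1) → S) → Option S
  | 0, x => some (x 0)
  | m + 1, x => (psum m (fun i => x i.castSucc)).bind (fun y => padd y (x (Fin.last (m + 1))))

/-- A family of finite sets is shift invariant if it contains `A + x = {a + x : a ∈ A}`
whenever it contains `A` and `x ∈ sig A`. -/
def ShiftInvariant (𝒜 : Set (Finset S)) : Prop :=
  ∀ A ∈ 𝒜, ∀ x ∈ sig A, ∃ B ∈ 𝒜, (B : Set S) = {y | ∃ a ∈ A, padd a x = some y}

/-- A family of finite sets is adequately partition regular if, for every finite `H ⊆ S` and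
every `r ≥ 1`, there is a finite `F ⊆ sig H` such that whenever `F` is a union of `r` sets,
one of them contains a member of the family. -/
def AdequatelyPartitionRegular (𝒜 : Set (Finset S)) : Prop :=
  ∀ (H : Finset S) (r : ℕ), 1 ≤ r → ∃ F : Finset S, (F : Set S) ⊆ sig H ∧
    ∀ C : Fin r → Set S, (F : Set S) = ⋃ i, C i → ∃ j, ∃ A ∈ 𝒜, (A : Set S) ⊆ C j

variable (S) in
/-- `δS`: the ultrafilters on `S` that contain `dom x` for every `x ∈ S`. -/
abbrev DeltaS : Type _ := {p : Ultrafilter S // ∀ x : S, dom x ∈ p}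

theorem shiftSet_inter (s : S) (A B : Set S) :
    shiftSet s (A ∩ B) = shiftSet s A ∩ shiftSet s B := by
  ext t
  constructor
  · rintro ⟨u, ⟨hA, hB⟩, h⟩
    exact ⟨⟨u, hA, h⟩, ⟨u, hB, h⟩⟩
  · rintro ⟨⟨u, hA, h⟩, ⟨v, hB, h'⟩⟩
    have huv : u = v := Option.some.inj (h.symm.trans h')
    subst huv
    exact ⟨u, ⟨hA, hB⟩, h⟩

theorem shiftSet_mono (s : S) {A B : Set S} (h : A ⊆ B) : shiftSet s A ⊆ shiftSet s B :=
  fun _ ⟨u, hu, hs⟩ => ⟨u, h hu, hs⟩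

theorem shiftSet_compl_mem_iff (q : DeltaS S) (s : S) (A : Set S) :
    shiftSet s Aᶜ ∈ q.1 ↔ shiftSet s A ∉ q.1 := by
  rw [← Ultrafilter.compl_mem_iff_notMem]
  constructor
  · intro h
    refine Filter.mem_of_superset h ?_
    rintro t ⟨u, hu, hs⟩ ⟨v, hv, hs'⟩
    have huv : u = v := Option.some.inj (hs.symm.trans hs')
    exact hu (huv ▸ hv)
  · intro h
    refine Filter.mem_of_superset (Filter.inter_mem h (q.2 s)) ?_
    rintro t ⟨ht, u, hu⟩
    exact ⟨u, fun hA => ht ⟨u, hA, hu⟩, hu⟩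

/-- For `p ∈ βS` and `q ∈ δS`, the ultrafilter `p + q` with
`A ∈ p + q ↔ {a : -a + A ∈ q} ∈ p`. -/
def ultraAdd (p : Ultrafilter S) (q : DeltaS S) : Ultrafilter S :=
  Ultrafilter.ofComplNotMemIff
    { sets := {A | {a | shiftSet a A ∈ q.1} ∈ p}
      univ_sets := Filter.mem_of_superset Filter.univ_mem (fun a _ =>
        Filter.mem_of_superset (q.2 a) (fun _ ⟨u, hu⟩ => ⟨u, trivial, hu⟩))
      sets_of_superset := fun hA hAB =>
        Filter.mem_of_superset hA (fun a ha => Filter.mem_of_superset ha (shiftSet_mono a hAB))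
      inter_sets := fun hA hB =>
        Filter.mem_of_superset (Filter.inter_mem hA hB) (fun a ha => by
          change shiftSet a _ ∈ q.1
          rw [shiftSet_inter]
          exact Filter.inter_mem ha.1 ha.2) }
    (fun A => by
      change ({a | shiftSet a Aᶜ ∈ q.1} ∉ p) ↔ ({a | shiftSet a A ∈ q.1} ∈ p)
      have h : {a | shiftSet a Aᶜ ∈ q.1} = {a | shiftSet a A ∈ q.1}ᶜ :=
        Set.ext fun a => shiftSet_compl_mem_iff q a A
      rw [h, Ultrafilter.compl_notMem_iff])

theorem mem_ultraAdd {p : Ultrafilter S} {q : DeltaS S} {A : Set S} :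
    A ∈ ultraAdd p q ↔ {a | shiftSet a A ∈ q.1} ∈ p := Iff.rfl

theorem dom_mem_ultraAdd (p q : DeltaS S) (x : S) : dom x ∈ ultraAdd p.1 q := by
  rw [mem_ultraAdd]
  refine Filter.mem_of_superset (p.2 x) ?_
  rintro a ⟨u, hu⟩
  refine Filter.mem_of_superset (q.2 u) ?_
  rintro b ⟨v, hv⟩
  have h := padd_assoc x a b
  rw [hu, Option.bind_some, hv] at h
  obtain ⟨w, hw, hxw⟩ := Option.bind_eq_some_iff.mp h.symm
  exact ⟨w, ⟨v, hxw⟩, hw⟩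

/-- The operation of `δS`. -/
instance : Add (DeltaS S) := ⟨fun p q => ⟨ultraAdd p.1 q, dom_mem_ultraAdd p q⟩⟩

/-- `L` is a left ideal of `δS`. -/
def IsLeftIdeal (L : Set (DeltaS S)) : Prop :=
  L.Nonempty ∧ ∀ q : DeltaS S, ∀ p ∈ L, q + p ∈ L

variable (S) in
/-- `K(δS)`: the union of all minimal left ideals of `δS`. -/
def KDelta : Set (DeltaS S) := {p | ∃ L : Set (DeltaS S), Minimal IsLeftIdeal L ∧ p ∈ L}

end PartialAddCommSemigroup

namespace PartialAddCommSemigroup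

variable {S : Type*} [PartialAddCommSemigroup S]

/-! For a shift invariant, adequately partition regular family `𝒜`, `containing 𝒜` is a nonempty
two-sided ideal of `δS`, so it contains `K(δS)` (`KDelta_subset_containing`). Hence every member of
`p` contains some `A s t`, for each `s`. The sequence is built by recursion with sets `W n ∈ p`:
idempotence lets `A s t` be chosen among those `a ∈ W n ∩ C n` with `-a + (W n ∩ C n) ∈ p`, and `W
(n + 1)` is `W n` intersected with these finitely many shifts. Adding summands from the last to the
first then stays in the required sets (`exists_psum_eq_some`). -/

theorem mem_add_iff {p q : DeltaS S} {B : Set S} :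
    B ∈ (p + q).1 ↔ {a | shiftSet a B ∈ q.1} ∈ p.1 := Iff.rfl

/-- The iterated sum can be computed by splitting off the first summand. -/
theorem psum_succ_left (m : ℕ) (x : Fin (m + 2) → S) :
    psum (m + 1) x = (psum m (fun i => x i.succ)).bind (fun y => padd (x 0) y) := by
  induction m with
  | zero => rfl
  | succ m ih =>
    have h : psum (m + 2) x = (psum (m + 1) (fun i => x i.castSucc)).bind
        (fun y => padd y (x (Fin.last (m + 2)))) := rfl
    have h' : psum (m + 1) (fun i => x i.succ) = (psum m (fun i => x i.castSucc.succ)).bind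
        (fun y => padd y (x (Fin.last (m + 2)))) := rfl
    rw [h, ih, h', Option.bind_assoc, Option.bind_assoc]
    exact congrArg _ (funext fun y => padd_assoc _ _ _)

/-- The ultrafilters in `δS` all of whose members contain a member of `𝒜`. -/
def containing (𝒜 : Set (Finset S)) : Set (DeltaS S) :=
  {q | ∀ B ∈ q.1, ∃ A ∈ 𝒜, (A : Set S) ⊆ B}

/-- The domains and the complements of bad sets have the finite intersection property: otherwise
some `F ⊆ sig H` would be covered by finitely many bad sets. Any ultrafilter containing them all
works. -/
theorem AdequatelyPartitionRegular.containing_nonempty {𝒜 : Set (Finset S)}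
    (hreg : AdequatelyPartitionRegular 𝒜) (hne : ∀ A ∈ 𝒜, A.Nonempty) :
    (containing 𝒜).Nonempty := by
  classical
  let bad : Set (Set S) := {D | ¬ ∃ A ∈ 𝒜, (A : Set S) ⊆ D}
  let gen : Set (Set S) := Set.range (dom : S → Set S) ∪ compl '' bad
  have hfip : (Filter.generate gen).NeBot := by
    rw [Filter.generate_neBot_iff]
    intro t ht htfin
    have hd : (t ∩ Set.range (dom : S → Set S)).Finite := htfin.subset Set.inter_subset_left
    have hb : (t ∩ compl '' bad).Finite := htfin.subset Set.inter_subset_left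
    obtain ⟨H, hH⟩ : ∃ H : Finset S,
        ∀ d ∈ t ∩ Set.range (dom : S → Set S), ∃ s ∈ H, dom s = d := by
      choose f hf using fun d : hd.toFinset => (hd.mem_toFinset.mp d.2).2
      exact ⟨Finset.univ.image f, fun d h => ⟨f ⟨d, hd.mem_toFinset.mpr h⟩,
        Finset.mem_image_of_mem f (Finset.mem_univ _), hf _⟩⟩
    let N := hb.toFinset.card
    let e : Fin N ≃ hb.toFinset := hb.toFinset.equivFin.symm
    obtain ⟨F, hF, hFC⟩ := hreg H (N + 1) (by omega)
    by_contra hempty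
    rw [Set.not_nonempty_iff_eq_empty] at hempty
    -- The extra empty cell keeps the number of cells positive when `N = 0`; it contains no member
    -- of `𝒜`, as members are nonempty.
    let D : Fin (N + 1) → Set S := Fin.cases ∅ (fun i => F ∩ (e i : Set S)ᶜ)
    have hcover : (F : Set S) = ⋃ i, D i := by
      ext x
      simp only [Set.mem_iUnion]
      constructor
      · intro hx
        have hx' : x ∉ ⋂₀ t := by simp [hempty]
        simp only [Set.mem_sInter, not_forall] at hx'
        obtain ⟨d, hdt, hxd⟩ := hx'
        rcases ht hdt with hr | hbad
        · obtain ⟨s, hs, rfl⟩ := hH d ⟨hdt, hr⟩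
          exact absurd (hF hx s hs) hxd
        · refine ⟨(e.symm ⟨d, by simpa using ⟨hdt, by simpa using hbad⟩⟩).succ, hx, ?_⟩
          simpa using hxd
      · rintro ⟨i, hi⟩
        induction i using Fin.cases with
        | zero => exact hi.elim
        | succ i => exact hi.1
    obtain ⟨j, A, hA, hAj⟩ := hFC D hcover
    induction j using Fin.cases with
    | zero =>
      obtain ⟨a, ha⟩ := hne A hA
      exact hAj ha
    | succ i =>
      have hi := (hb.mem_toFinset.mp (e i).2).2
      obtain ⟨E, hE, hEi⟩ := hi
      refine hE ⟨A, hA, fun a ha => ?_⟩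
      have := (hAj ha).2
      rw [← hEi, compl_compl] at this
      exact this
  refine ⟨⟨Ultrafilter.of (Filter.generate gen), fun x => Ultrafilter.of_le _
    (Filter.mem_generate_of_mem (Or.inl ⟨x, rfl⟩))⟩, fun B hB => ?_⟩
  by_contra hbad
  have hc : Bᶜ ∈ Ultrafilter.of (Filter.generate gen) := Ultrafilter.of_le _
    (Filter.mem_generate_of_mem (Or.inr ⟨B, hbad, rfl⟩))
  exact Ultrafilter.compl_mem_iff_notMem.mp hc hB

theorem ShiftInvariant.add_mem_containing_left {𝒜 : Set (Finset S)} (h : ShiftInvariant 𝒜)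
    (r : DeltaS S) {q : DeltaS S} (hq : q ∈ containing 𝒜) : r + q ∈ containing 𝒜 := by
  intro B hB
  obtain ⟨a, ha⟩ := r.1.nonempty_of_mem (mem_add_iff.mp hB)
  obtain ⟨A, hA, hAB⟩ := hq _ ha
  obtain ⟨A', hA', hAA'⟩ := h A hA a fun s hs => by
    obtain ⟨u, -, hu⟩ := hAB hs
    exact ⟨u, by rw [padd_comm, hu]⟩
  refine ⟨A', hA', ?_⟩
  rw [hAA']
  rintro y ⟨b, hb, hy⟩
  obtain ⟨u, huB, hu⟩ := hAB hb
  rw [padd_comm, hy] at hu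
  exact Option.some.inj hu ▸ huB

/-- Since `A` is finite, a single `x` lies in all the shifts `-a + B` with `a ∈ A`, and then `A + x
⊆ B`. -/
theorem ShiftInvariant.add_mem_containing_right {𝒜 : Set (Finset S)} (h : ShiftInvariant 𝒜)
    {q : DeltaS S} (hq : q ∈ containing 𝒜) (r : DeltaS S) : q + r ∈ containing 𝒜 := by
  intro B hB
  obtain ⟨A, hA, hAB⟩ := hq _ (mem_add_iff.mp hB)
  obtain ⟨x, hx⟩ := r.1.nonempty_of_mem
    ((Filter.biInter_finset_mem A).mpr fun a ha => hAB ha)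
  have hx' : ∀ a ∈ A, x ∈ shiftSet a B := by simpa using hx
  obtain ⟨A', hA', hAA'⟩ := h A hA x fun s hs => by
    obtain ⟨u, -, hu⟩ := hx' s hs
    exact ⟨u, hu⟩
  refine ⟨A', hA', ?_⟩
  rw [hAA']
  rintro y ⟨b, hb, hy⟩
  obtain ⟨u, huB, hu⟩ := hx' b hb
  rw [hy] at hu
  exact Option.some.inj hu ▸ huB

/-- Every member of an ultrafilter in `K(δS)` contains a member of a shift invariant,
adequately partition regular family. -/
theorem KDelta_subset_containing {𝒜 : Set (Finset S)} (h : ShiftInvariant 𝒜)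
    (hreg : AdequatelyPartitionRegular 𝒜) (hne : ∀ A ∈ 𝒜, A.Nonempty) :
    KDelta S ⊆ containing 𝒜 := by
  rintro p ⟨L, hL, hpL⟩
  obtain ⟨q, hq⟩ := hreg.containing_nonempty hne
  -- `q + p` lies in `L` because `L` is a left ideal, and in `containing 𝒜` because `q` does;
  -- minimality of `L` then gives `L ⊆ containing 𝒜`.
  have hideal : IsLeftIdeal (L ∩ containing 𝒜) :=
    ⟨⟨q + p, hL.prop.2 q p hpL, h.add_mem_containing_right hq p⟩,
      fun r r' hr' => ⟨hL.prop.2 r r' hr'.1, h.add_mem_containing_left r hr'.2⟩⟩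
  exact (hL.le_of_le hideal Set.inter_subset_left hpL).2

/-- Iterated sums lie in the first of a decreasing sequence of sets as soon as each set absorbs
sums of an element of the corresponding `F n` with an element of a later set. -/
theorem exists_psum_eq_some (F : ℕ → Set S) (W C : ℕ → Set S) (hW : Antitone W)
    (hF : ∀ n, F n ⊆ W n ∩ C n)
    (hstep : ∀ n, ∀ a ∈ F n, W (n + 1) ⊆ shiftSet a (W n ∩ C n))
    (m : ℕ) (n : Fin (m + 1) → ℕ) (hn : StrictMono n) (x : Fin (m + 1) → S)
    (hx : ∀ i, x i ∈ F (n i)) : ∃ y ∈ W (n 0) ∩ C (n 0), psum m x = some y := by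
  induction m with
  | zero => exact ⟨x 0, hF _ (hx 0), rfl⟩
  | succ m ih =>
    obtain ⟨y, hy, hsum⟩ := ih (fun i => n i.succ)
      (fun i j hij => hn (Fin.succ_lt_succ_iff.mpr hij)) (fun i => x i.succ) (fun i => hx i.succ)
    have hlt : n 0 + 1 ≤ n (Fin.succ 0) := hn (Fin.succ_pos 0)
    -- The tail sum lies in `W (n 1)`, hence in the larger set `W (n 0 + 1)`.
    obtain ⟨z, hz, hxz⟩ := hstep _ _ (hx 0) (hW hlt hy.1)
    exact ⟨z, hz, by rw [psum_succ_left, hsum, Option.bind_some, hxz]⟩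

end PartialAddCommSemigroup

theorem theorem4p11 {S : Type*} [PartialAddCommSemigroup S]
    (_hS : PartialAddCommSemigroup.IsAdequate S)
    {U : Type*} {T : U → Type*} (A : (s : U) → T s → Finset S)
    (_hne : ∀ (s : U) (t : T s), (A s t).Nonempty)
    (hshift : ∀ s : U, PartialAddCommSemigroup.ShiftInvariant (Set.range (A s)))
    (hreg : ∀ s : U, PartialAddCommSemigroup.AdequatelyPartitionRegular (Set.range (A s)))
    (s₁ : U) (φ : (Σ s : U, T s) → U)
    (C : ℕ → Set S)
    (p : PartialAddCommSemigroup.DeltaS S)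
    (hpK : p ∈ PartialAddCommSemigroup.KDelta S) (hp : p + p = p)
    (hC : ∀ n : ℕ, C n ∈ p.1) :
    ∃ (s : ℕ → U) (t : (n : ℕ) → T (s n)),
      s 0 = s₁ ∧ (∀ n : ℕ, s (n + 1) = φ ⟨s n, t n⟩) ∧
      ∀ (m : ℕ) (n : Fin (m + 1) → ℕ), StrictMono n →
        ∀ x : Fin (m + 1) → S, (∀ i, x i ∈ A (s (n i)) (t (n i))) →
          ∃ y ∈ C (n 0), PartialAddCommSemigroup.psum m x = some y := by
  classical
  have key : ∀ (s : U) (B : Set S), B ∈ p.1 → ∃ t, (A s t : Set S) ⊆ B := by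
    intro s B hB
    obtain ⟨_, ⟨t, rfl⟩, ht⟩ := PartialAddCommSemigroup.KDelta_subset_containing (hshift s) (hreg s)
      (by rintro _ ⟨t, rfl⟩; exact _hne s t) hpK B hB
    exact ⟨t, ht⟩
  have hstar : ∀ B : Set S, B ∈ p.1 → B ∩ {a | PartialAddCommSemigroup.shiftSet a B ∈ p.1} ∈ p.1 := by
    intro B hB
    refine Filter.inter_mem hB (PartialAddCommSemigroup.mem_add_iff.mp ?_)
    rwa [hp]
  have hpick : ∀ (n : ℕ) (st : U × {W : Set S // W ∈ p.1}), ∃ t : T st.1,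
      (A st.1 t : Set S) ⊆ (st.2.1 ∩ C n) ∩ {a | PartialAddCommSemigroup.shiftSet a (st.2.1 ∩ C n) ∈ p.1} :=
    fun n st => key st.1 _ (hstar _ (Filter.inter_mem st.2.2 (hC n)))
  choose τ hτ using hpick
  -- The state is the current index in `U` together with `W n`.
  let next : ℕ → U × {W : Set S // W ∈ p.1} → U × {W : Set S // W ∈ p.1} := fun n st =>
    (φ ⟨st.1, τ n st⟩, ⟨st.2.1 ∩ ⋂ a ∈ A st.1 (τ n st), PartialAddCommSemigroup.shiftSet a (st.2.1 ∩ C n),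
      Filter.inter_mem st.2.2 ((Filter.biInter_finset_mem _).mpr fun a ha => (hτ n st ha).2)⟩)
  let st : ℕ → U × {W : Set S // W ∈ p.1} :=
    fun n => Nat.rec (s₁, ⟨Set.univ, Filter.univ_mem⟩) next n
  refine ⟨fun n => (st n).1, fun n => τ n (st n), rfl, fun n => rfl, fun m n hn x hx => ?_⟩
  obtain ⟨y, hy, hsum⟩ := PartialAddCommSemigroup.exists_psum_eq_some (fun n => (A (st n).1 (τ n (st n)) : Set S))
    (fun n => (st n).2.1) C (antitone_nat_of_succ_le fun n => Set.inter_subset_left)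
    (fun n a ha => (hτ n (st n) ha).1)
    (fun n a ha w hw => Set.mem_iInter₂.mp hw.2 a ha) m n hn x hx
  exact ⟨y, hy.2, hsum⟩
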